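/- Let $\beta>1$ be a Pisot number (an algebraic integer $>1$ all of whose other conjugates have modulus $<1$) with minimal polynomial $x^{d}-a_{d-1}x^{d-1}-\cdots-a_{1}x-a_{0}$ over $\mathbb{Z}$. For $l=(l_1,\dots,l_{d-1})\in\mathbb{Z}^{d-1}$ put $\lambda(l)=\sum_{j=1}^{d-1}r_j l_j$, where $r_j=\sum_{i=1}^{j}a_{j-i}\beta^{-i}$, and define $$\tau(l)=(l_2,\dots,l_{d-1},-\lfloor\lambda(l)\rfloor),\qquad \tau^{*}(l)=-\tau(-l),\qquad l_I=(0,\dots,0,1).$$ Let - $F_\beta=\{l\in\mathbb{Z}^{d-1} : \tau^{k}(l)=0 \text{ for some } k\ge 0\}$; - $V_\beta=\{-\sum_{n=1}^{r}\omega_n\tau^{n-1}(l_I) : r\ge 1,\ \omega_1,\dots,\omega_r\in\mathbb{Z}_{\ge 0}\}$; - $Q_\beta$ be the set of all $l\in\mathbb{Z}^{d-1}$ for which there is a finite sequence $l^{(1)}=l_I,\ l^{(2)},\dots,l^{(N)}=l$ ($N\ge1$) with $l^{(n+1)}\in\{\tau(l^{(n)}),\tau^{*}(l^{(n)})\}$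 for all $1\le n<N$; - $P_\beta=\{l\in Q_\beta\setminus\{0\} : \tau^{N}(l)=l \text{ for some } N\ge 1\}$, which is a finite set; - $\delta=\max\{|l_j| : (l_1,\dots,l_{d-1})\in P_\beta,\ 1\le j\le d-1\}$ (with $\delta=0$ if $P_\beta$ is empty). Suppose that (i) $\tau^{-1}(P_\beta)\subset P_\beta$, and (ii) $\{-\delta,\dots,\delta\}^{d-1}\cap V_\beta\subset F_\beta$. Then $\beta$ has property (F$_1$): every integer $m\ge 0$ has a finite beta-expansion. That is, with $T(x)=\{\beta x\}$ (fractional part), $L(m)=\min\{n\in\mathbb{Z}_{\ge0} : m\beta^{-n}<1\}$ and $x=m\beta^{-L(m)}$, only finitely many of the digits $c_n=\lfloor\beta\,T^{n-1}(x)\rfloor$ $(n\ge1)$ are nonzero. -/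

import Mathlib

open Polynomial

/-- A Pisot number: an algebraic integer `β > 1` all of whose conjugates (complex roots of its
minimal polynomial) other than `β` itself have modulus less than `1`. -/
def IsPisot (β : ℝ) : Prop :=
  1 < β ∧ IsIntegral ℤ β ∧
    ∀ z : ℂ, aeval z (minpoly ℤ β) = 0 → z ≠ (β : ℂ) → ‖z‖ < 1

section BetaExpansion

/-- The `β`-transformation `T(x) = {βx}`. -/
noncomputable def betaT (β : ℝ) (x : ℝ) : ℝ := Int.fract (β * x)

/-- The digits of `d_β(x)`, numbered from `0`: `betaDigit β x n` is `c_{n+1} = ⌊β Tⁿ(x)⌋`. -/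
noncomputable def betaDigit (β : ℝ) (x : ℝ) (n : ℕ) : ℤ := ⌊β * (betaT β)^[n] x⌋

/-- `L(x) = min {n ∈ ℕ₀ | x β⁻ⁿ < 1}` (the set is non-empty for `β > 1`). -/
noncomputable def betaL (β : ℝ) (x : ℝ) : ℕ := sInf {n : ℕ | x * (β ^ n)⁻¹ < 1}

/-- `Fin(β)`: the nonnegative reals `x` whose beta-expansion, with digit sequence
`d_β(β^{-L(x)} x)`, has only finitely many nonzero digits. -/
def betaFin (β : ℝ) : Set ℝ :=
  {x | 0 ≤ x ∧ {n : ℕ | betaDigit β ((β ^ betaL β x)⁻¹ * x) n ≠ 0}.Finite}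

/-- Property (F₁): every natural number (including `0`) has a finite beta-expansion. -/
def PropertyF1 (β : ℝ) : Prop := ∀ n : ℕ, (n : ℝ) ∈ betaFin β

end BetaExpansion

section ShiftRadixSystem

/-- The degree `d` of the algebraic integer `β`. -/
noncomputable def betaDeg (β : ℝ) : ℕ := (minpoly ℤ β).natDegree

/-- The integers `a_i` for which the minimal polynomial of `β` is
`x^d - a_{d-1} x^{d-1} - ⋯ - a_1 x - a_0`. -/
noncomputable def betaCoeff (β : ℝ) (i : ℕ) : ℤ := -(minpoly ℤ β).coeff i

/-- The lattice `ℤ^{d-1}`; the coordinate `l_j` (`1 ≤ j ≤ d-1`) has index `j - 1`. -/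
abbrev SRSLattice (β : ℝ) : Type := Fin (betaDeg β - 1) → ℤ

/-- The vector `r = (r_1, …, r_{d-1})`, `r_j = ∑_{i=1}^{j} a_{j-i} β^{-i}`
(here `j = k + 1`). -/
noncomputable def srsVec (β : ℝ) (k : Fin (betaDeg β - 1)) : ℝ :=
  ∑ i ∈ Finset.Icc 1 ((k : ℕ) + 1), (betaCoeff β ((k : ℕ) + 1 - i) : ℝ) * (β ^ i)⁻¹

/-- `λ(l) = r · l`. -/
noncomputable def srsLambda (β : ℝ) (l : SRSLattice β) : ℝ := ∑ k, srsVec β k * (l k : ℝ)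

/-- The shift radix system `τ(l_1, …, l_{d-1}) = (l_2, …, l_{d-1}, -⌊λ(l)⌋)`. -/
noncomputable def srsTau (β : ℝ) (l : SRSLattice β) : SRSLattice β := fun k =>
  if h : (k : ℕ) + 1 < betaDeg β - 1 then l ⟨(k : ℕ) + 1, h⟩ else -⌊srsLambda β l⌋

/-- `τ*(l) = -τ(-l)`. -/
noncomputable def srsTauStar (β : ℝ) (l : SRSLattice β) : SRSLattice β := -srsTau β (-l)

/-- `l_I = (0, …, 0, 1)` (the empty vector when `d = 1`). -/
noncomputable def srsI (β : ℝ) : SRSLattice β := fun k => if (k : ℕ) + 1 = betaDeg β - 1 then 1 else 0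

/-- `F_β`: the vectors whose `τ`-orbit reaches `0`. -/
def srsF (β : ℝ) : Set (SRSLattice β) := {l | ∃ k : ℕ, (srsTau β)^[k] l = 0}

/-- `V_β`: the vectors `-∑_{n=1}^{r} ω_n τ^{n-1}(l_I)` with `r ≥ 1` and `ω_n ∈ ℕ₀`
(the summation index is shifted by one). -/
def srsV (β : ℝ) : Set (SRSLattice β) :=
  {l | ∃ (r : ℕ) (ω : ℕ → ℕ), 1 ≤ r ∧
    l = -∑ n ∈ Finset.range r, ω n • (srsTau β)^[n] (srsI β)}

/-- `Q_β`: the endpoints of finite chains `w 0 = l_I, w 1, …, w N` in which each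
`w (n+1)` is `τ (w n)` or `τ* (w n)`. -/
def srsQ (β : ℝ) : Set (SRSLattice β) :=
  {l | ∃ (N : ℕ) (w : ℕ → SRSLattice β), w 0 = srsI β ∧ w N = l ∧
    ∀ n < N, w (n + 1) = srsTau β (w n) ∨ w (n + 1) = srsTauStar β (w n)}

/-- `P_β`: the nonzero elements of `Q_β` that are purely periodic under `τ`. -/
def srsP (β : ℝ) : Set (SRSLattice β) :=
  {l | l ∈ srsQ β ∧ l ≠ 0 ∧ ∃ N : ℕ, 1 ≤ N ∧ (srsTau β)^[N] l = l}

/-- `δ = max {|l_j| | l ∈ P_β, 1 ≤ j ≤ d-1}`. For a Pisot number the set `P_β` is finite, so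
the supremum is a maximum when `P_β` is non-empty; it is `0` when `P_β` is empty. -/
noncomputable def srsDelta (β : ℝ) : ℕ := sSup {m : ℕ | ∃ l ∈ srsP β, ∃ j, m = (l j).natAbs}

end ShiftRadixSystem

/-! Via l ↦ fract λ(l), τ becomes the β-transformation T (`fract_srsLambda_srsTau`). For an integer
m with x = mβ^{-L}, the number T^L(x) is congruent modulo 1 to λ(l) for some l in the monoid
generated by the vectors -τⁿ(l_I). So it suffices that every τ-orbit in this monoid reaches 0
(`srsNegMonoid_subset_srsF`).

If -l_I ∈ Q_β, then Q_β is symmetric and generators can be added one at a time: perturbing l by an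
element of Q_β perturbs its orbit only by elements of Q_β (`srsTau_add`). When the orbit of l has
reached 0, only some q ∈ Q_β is left. As Q_β is finite (`finite_srsQ`, the Pisot property), q
reaches 0 or P_β; in the latter case (i) puts the perturbed vector itself in P_β, and (ii) applies.

A nonzero v ∈ Q_β with τ(v) = 0 gives τ*(v) = -l_I ∈ Q_β. Without such a v, `exists_eq_nsmul_srsI`
leaves only d ≤ 2, which is settled directly. -/

/-! ### The numbers r_j. -/

/-- The extension of `srsVec` to all indices: `srsR β j = r_j`, with `r_0 = 0`. -/
noncomputable def srsR (β : ℝ) (j : ℕ) : ℝ :=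
  ∑ i ∈ Finset.Icc 1 j, (betaCoeff β (j - i) : ℝ) * (β ^ i)⁻¹

theorem srsR_zero (β : ℝ) : srsR β 0 = 0 := by simp [srsR]

theorem srsVec_eq_srsR (β : ℝ) (k : Fin (betaDeg β - 1)) : srsVec β k = srsR β ((k : ℕ) + 1) := rfl

theorem srsR_eq_sum_range (β : ℝ) (j : ℕ) :
    srsR β j = ∑ i ∈ Finset.range j, (betaCoeff β (j - (i + 1)) : ℝ) * (β ^ (i + 1))⁻¹ := by
  rw [srsR, ← Finset.Ico_add_one_right_eq_Icc, Finset.sum_Ico_eq_sum_range]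
  exact Finset.sum_congr (by simp) fun i _ => by rw [add_comm 1 i]

/-- This is one step of Horner's scheme for dividing the minimal polynomial by X - β. -/
theorem mul_srsR_succ {β : ℝ} (h : β ≠ 0) (j : ℕ) :
    β * srsR β (j + 1) = betaCoeff β j + srsR β j := by
  rw [srsR_eq_sum_range, srsR_eq_sum_range, Finset.sum_range_succ', mul_add, Finset.mul_sum,
    add_comm]
  congr 1
  · simp only [zero_add, pow_one, Nat.add_sub_cancel]
    field_simp
  · refine Finset.sum_congr rfl fun i _ => ?_
    rw [show j + 1 - (i + 1 + 1) = j - (i + 1) by omega, pow_succ β (i + 1)]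
    field_simp

theorem pow_mul_srsR {β : ℝ} (h : β ≠ 0) (j : ℕ) :
    β ^ j * srsR β j = ∑ i ∈ Finset.range j, (betaCoeff β i : ℝ) * β ^ i := by
  induction j with
  | zero => simp [srsR_zero]
  | succ j ih =>
    rw [Finset.sum_range_succ, ← ih, pow_succ, mul_assoc, mul_srsR_succ h]
    ring

namespace IsPisot

variable {β : ℝ}

theorem pos (hβ : IsPisot β) : 0 < β := zero_lt_one.trans hβ.1

theorem ne_zero (hβ : IsPisot β) : β ≠ 0 := hβ.pos.ne'

theorem betaDeg_pos (hβ : IsPisot β) : 0 < betaDeg β := minpoly.natDegree_pos hβ.2.1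

theorem betaDeg_sub_add (hβ : IsPisot β) : betaDeg β - 1 + 1 = betaDeg β :=
  Nat.sub_add_cancel hβ.betaDeg_pos

/-- This expresses that β is a root. It lets -⌊λ(l)⌋ act as a d-th coordinate of l. -/
theorem srsR_betaDeg (hβ : IsPisot β) : srsR β (betaDeg β) = 1 := by
  have h := minpoly.aeval ℤ β
  rw [aeval_eq_sum_range, Finset.sum_range_succ, (minpoly.monic hβ.2.1).coeff_natDegree,
    one_smul] at h
  have h2 := pow_mul_srsR hβ.ne_zero (betaDeg β)
  have h3 : ∑ i ∈ Finset.range (betaDeg β), (betaCoeff β i : ℝ) * β ^ i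
      = -∑ i ∈ Finset.range (minpoly ℤ β).natDegree, (minpoly ℤ β).coeff i • β ^ i := by
    rw [← Finset.sum_neg_distrib]
    exact Finset.sum_congr rfl fun i _ => by simp [betaCoeff]
  have h4 : β ^ betaDeg β ≠ 0 := pow_ne_zero _ hβ.ne_zero
  refine mul_left_cancel₀ h4 ?_
  rw [h2, h3, mul_one, betaDeg]
  linarith

theorem betaCoeff_zero_ne_zero (hβ : IsPisot β) : betaCoeff β 0 ≠ 0 := by
  have h := minpoly.coeff_zero_ne_zero (A := ℚ) hβ.2.1.tower_top hβ.ne_zero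
  rw [minpoly.isIntegrallyClosed_eq_field_fractions' ℚ hβ.2.1, coeff_map] at h
  exact neg_ne_zero.2 fun h0 => h (by rw [h0, map_zero])

/-- The powers `1, β, …, β^{d-1}` are linearly independent over `ℤ`. -/
theorem eq_zero_of_aeval_eq_zero (hβ : IsPisot β) {p : ℤ[X]} (hp : p.natDegree < betaDeg β)
    (h : aeval β p = 0) : p = 0 := by
  by_contra h0
  exact absurd (natDegree_le_of_dvd (minpoly.isIntegrallyClosed_dvd hβ.2.1 h) h0) (not_le.2 hp)

end IsPisot

/-! ### Conjugacy with the β-transformation. -/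

/-- The entries of `l`, followed by `-⌊λ(l)⌋` (and then zeros). -/
noncomputable def srsExt (β : ℝ) (l : SRSLattice β) (j : ℕ) : ℤ :=
  if h : j < betaDeg β - 1 then l ⟨j, h⟩ else if j = betaDeg β - 1 then -⌊srsLambda β l⌋ else 0

theorem srsLambda_eq_sum_range {β : ℝ} (l : SRSLattice β) (f : ℕ → ℤ) (hf : ∀ k, l k = f k) :
    srsLambda β l = ∑ j ∈ Finset.range (betaDeg β - 1), srsR β (j + 1) * (f j : ℝ) := by
  rw [srsLambda, Finset.sum_range]
  exact Finset.sum_congr rfl fun k _ => by rw [srsVec_eq_srsR, hf]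

theorem srsExt_coe (β : ℝ) (l : SRSLattice β) (k : Fin (betaDeg β - 1)) : l k = srsExt β l k := by
  simp [srsExt]

theorem srsTau_eq_srsExt (β : ℝ) (l : SRSLattice β) (k : Fin (betaDeg β - 1)) :
    srsTau β l k = srsExt β l (k + 1) := by
  have := k.2
  simp only [srsTau, srsExt]
  split_ifs <;> first | rfl | omega

theorem srsLambda_add (β : ℝ) (l l' : SRSLattice β) :
    srsLambda β (l + l') = srsLambda β l + srsLambda β l' := by
  simp [srsLambda, mul_add, Finset.sum_add_distrib]

theorem srsLambda_neg (β : ℝ) (l : SRSLattice β) : srsLambda β (-l) = -srsLambda β l := by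
  simp [srsLambda]

theorem srsLambda_zero (β : ℝ) : srsLambda β 0 = 0 := by simp [srsLambda]

theorem srsTau_zero (β : ℝ) : srsTau β 0 = 0 := by
  ext k
  simp [srsTau, srsLambda_zero]

theorem srsTau_iterate_zero (β : ℝ) (n : ℕ) : (srsTau β)^[n] 0 = 0 :=
  Function.iterate_fixed (srsTau_zero β) n

/-- The shift radix system is conjugate to the `β`-transformation. -/
theorem IsPisot.fract_srsLambda_srsTau {β : ℝ} (hβ : IsPisot β) (l : SRSLattice β) :
    Int.fract (srsLambda β (srsTau β l)) = betaT β (Int.fract (srsLambda β l)) := by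
  set D := betaDeg β - 1 with hD
  have h1 : Int.fract (srsLambda β l)
      = ∑ j ∈ Finset.range (D + 1), srsR β (j + 1) * (srsExt β l j : ℝ) := by
    rw [Finset.sum_range_succ, ← srsLambda_eq_sum_range l _ (srsExt_coe β l), hβ.betaDeg_sub_add,
      hβ.srsR_betaDeg, Int.fract]
    simp [srsExt, hD, sub_eq_add_neg]
  -- Horner's relation turns r_{j+1} into r_j plus an integer, which shifts the entries by one
  -- place; the first entry drops out because r_0 = 0.
  have h2 : β * Int.fract (srsLambda β l) = srsLambda β (srsTau β l)
      + ((∑ j ∈ Finset.range (D + 1), betaCoeff β j * srsExt β l j : ℤ) : ℝ) := by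
    rw [h1, srsLambda_eq_sum_range _ (fun j => srsExt β l (j + 1)) (srsTau_eq_srsExt β l),
      Finset.mul_sum]
    have : ∀ j ∈ Finset.range (D + 1), β * (srsR β (j + 1) * (srsExt β l j : ℝ))
        = srsR β j * (srsExt β l j : ℝ) + ((betaCoeff β j * srsExt β l j : ℤ) : ℝ) := by
      intro j _
      rw [← mul_assoc, mul_srsR_succ hβ.ne_zero]
      push_cast
      ring
    rw [Finset.sum_congr rfl this, Finset.sum_add_distrib, Finset.sum_range_succ', srsR_zero]
    push_cast
    ring
  rw [betaT, h2, Int.fract_add_intCast]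

theorem IsPisot.fract_srsLambda_iterate {β : ℝ} (hβ : IsPisot β) (l : SRSLattice β) (n : ℕ) :
    Int.fract (srsLambda β ((srsTau β)^[n] l)) = (betaT β)^[n] (Int.fract (srsLambda β l)) := by
  induction n with
  | zero => rfl
  | succ n ih =>
    rw [Function.iterate_succ_apply', Function.iterate_succ_apply', hβ.fract_srsLambda_srsTau, ih]

theorem IsPisot.fract_srsLambda_srsI {β : ℝ} (hβ : IsPisot β) :
    Int.fract (srsLambda β (srsI β)) = betaT β 1 := by
  have h := mul_srsR_succ hβ.ne_zero (betaDeg β - 1)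
  rw [hβ.betaDeg_sub_add, hβ.srsR_betaDeg] at h
  have h2 : srsLambda β (srsI β) = srsR β (betaDeg β - 1) := by
    rw [srsLambda_eq_sum_range (srsI β) (fun k => if k + 1 = betaDeg β - 1 then 1 else 0)
      (fun k => rfl)]
    rcases hD : betaDeg β - 1 with _ | D
    · simp [srsR_zero]
    · simp
  rw [betaT, h, add_comm, Int.fract_add_intCast, h2]

/-- The numbers `r_1, …, r_{d-1}, 1` are linearly independent over `ℤ`. -/
theorem IsPisot.eq_zero_of_srsLambda_eq_intCast {β : ℝ} (hβ : IsPisot β) {l : SRSLattice β} {m : ℤ}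
    (h : srsLambda β l = m) : l = 0 := by
  by_contra hl
  have hne : ∃ k, l k ≠ 0 := by
    by_contra! h0
    exact hl (funext h0)
  obtain ⟨J, hJ, hmax⟩ : ∃ J, l J ≠ 0 ∧ ∀ k, J < k → l k = 0 := by
    obtain ⟨J, hJ⟩ := (Set.toFinite {k | l k ≠ 0}).exists_maximal hne
    exact ⟨J, hJ.prop, fun k hk => by_contra fun h0 => absurd (hJ.le_of_ge h0 hk.le) (not_le.2 hk)⟩
  have hJD := J.2
  -- `β ^ j * r_j` is the value at `β` of a truncation `q j` of the minimal polynomial.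
  let q : ℕ → ℤ[X] := fun j => ∑ i ∈ Finset.range j, C (betaCoeff β i) * X ^ i
  have hq : ∀ j, aeval β (q j) = β ^ j * srsR β j := fun j => by
    rw [pow_mul_srsR hβ.ne_zero]
    simp [q]
  have hq0 : ∀ j, (q (j + 1)).coeff 0 = betaCoeff β 0 := fun j => by
    simp [q, coeff_X_pow]
  have hqd : ∀ j, (q (j + 1)).natDegree ≤ j := fun j => by
    refine natDegree_sum_le_of_forall_le _ _ fun i hi => ?_
    exact (natDegree_C_mul_X_pow_le _ _).trans (Nat.lt_succ_iff.1 (Finset.mem_range.1 hi))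
  let f : ℕ → ℤ := srsExt β l
  have hf : ∀ j, (J : ℕ) < j → j < betaDeg β - 1 → f j = 0 := fun j h1 h2 => by
    have := srsExt_coe β l ⟨j, h2⟩
    rw [hmax ⟨j, h2⟩ h1] at this
    exact this.symm
  -- The value p(β) is β^{J+1}(λ(l) - m) = 0 and deg p < d, so p = 0. Its constant term comes from j
  -- = J alone and equals l_J a_0 ≠ 0.
  let p : ℤ[X] := (∑ j ∈ Finset.range (J + 1), C (f j) * (X ^ (J - j : ℕ) * q (j + 1)))
    - C m * X ^ (J + 1 : ℕ)
  have hsum : srsLambda β l = ∑ j ∈ Finset.range (J + 1), srsR β (j + 1) * (f j : ℝ) := by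
    rw [srsLambda_eq_sum_range l f (srsExt_coe β l)]
    symm
    refine Finset.sum_subset (Finset.range_subset_range.2 hJD) fun j h1 h2 => ?_
    rw [Finset.mem_range] at h1 h2
    rw [hf j (by omega) h1]
    simp
  have hp : aeval β p = 0 := by
    have : ∀ j ∈ Finset.range (J + 1 : ℕ), aeval β (C (f j) * (X ^ (J - j : ℕ) * q (j + 1)))
        = β ^ (J + 1 : ℕ) * (srsR β (j + 1) * (f j : ℝ)) := by
      intro j hj
      rw [Finset.mem_range] at hj
      rw [map_mul, map_mul, hq, show (J + 1 : ℕ) = (J - j) + (j + 1) by omega]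
      simp
      ring
    rw [map_sub, map_sum, Finset.sum_congr rfl this, ← Finset.mul_sum, ← hsum, h]
    simp
    ring
  have hdeg : p.natDegree < betaDeg β := by
    have h1 : p.natDegree ≤ (J : ℕ) + 1 := by
      refine (natDegree_sub_le _ _).trans (max_le ?_ (natDegree_C_mul_X_pow_le _ _))
      refine natDegree_sum_le_of_forall_le _ _ fun j hj => ?_
      rw [Finset.mem_range] at hj
      refine (natDegree_C_mul_le _ _).trans (natDegree_mul_le.trans ?_)
      have := hqd j
      rw [natDegree_X_pow]
      omega
    omega
  have h0 := congrArg (fun r => coeff r 0) (hβ.eq_zero_of_aeval_eq_zero hdeg hp)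
  have hfJ : f J = l J := (srsExt_coe β l J).symm
  have hz : ∀ j ∈ Finset.range (J : ℕ), (C (f j) * (X ^ (J - j : ℕ) * q (j + 1))).coeff 0 = 0 := by
    intro j hj
    rw [Finset.mem_range] at hj
    have : (J - j : ℕ) ≠ 0 := by omega
    simp [mul_coeff_zero, coeff_X_pow, this.symm]
  simp only [p, coeff_sub, Finset.sum_range_succ, coeff_add] at h0
  rw [finsetSum_coeff, Finset.sum_eq_zero hz] at h0
  simp [mul_coeff_zero, hq0, hfJ, hJ, hβ.betaCoeff_zero_ne_zero] at h0

/-! ### Boundedness for contracting recurrences. -/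

/-- The shift operator on complex sequences. -/
noncomputable def seqShift : Module.End ℂ (ℕ → ℂ) := LinearMap.funLeft ℂ ℂ Nat.succ

theorem seqShift_pow_apply (j : ℕ) (u : ℕ → ℂ) (n : ℕ) : (seqShift ^ j) u n = u (n + j) := by
  induction j generalizing n with
  | zero => rfl
  | succ j ih =>
    rw [pow_succ', Module.End.mul_apply]
    change (seqShift ^ j) u (n + 1) = _
    rw [ih, add_right_comm, add_assoc]

theorem aeval_seqShift_X_sub_C (a : ℂ) (u : ℕ → ℂ) (n : ℕ) :
    aeval seqShift (X - C a) u n = u (n + 1) - a * u n := by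
  simp [seqShift, LinearMap.funLeft, Module.algebraMap_end_apply]

/-- A sequence is bounded if a polynomial with all roots in the open unit disc maps it to a
bounded sequence; the bound depends only on the given bounds. -/
theorem exists_bound_of_aeval_seqShift (s : Multiset ℂ) (hs : ∀ z ∈ s, ‖z‖ < 1) (K : ℝ) :
    ∃ B : ℝ, ∀ u : ℕ → ℂ, (∀ i < s.card, ‖u i‖ ≤ K) →
      (∀ n, ‖aeval seqShift (s.map fun z => X - C z).prod u n‖ ≤ K) → ∀ n, ‖u n‖ ≤ B := by
  induction s using Multiset.induction_on generalizing K with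
  | empty => exact ⟨K, fun u _ h n => by simpa using h n⟩
  | cons a s ih =>
    -- Since ‖a‖ < 1, the first terms of u(n+1) - a u(n) are at most 2K.
    obtain ⟨B, hB⟩ := ih (fun z hz => hs z (Multiset.mem_cons_of_mem hz)) (2 * K)
    have ha : ‖a‖ < 1 := hs a (Multiset.mem_cons_self a s)
    -- This bound is preserved by t ↦ B + ‖a‖t.
    refine ⟨K + B / (1 - ‖a‖), fun u hu h => ?_⟩
    have hK : 0 ≤ K := (norm_nonneg _).trans (h 0)
    rw [Multiset.map_cons, Multiset.prod_cons, mul_comm, map_mul] at h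
    have hv := hB (aeval seqShift (X - C a) u) (fun i hi => ?_) fun n => (h n).trans (by linarith)
    · have hB0 : 0 ≤ B := (norm_nonneg _).trans (hv 0)
      have ha' : 0 < 1 - ‖a‖ := sub_pos.2 ha
      have hd : 0 ≤ B / (1 - ‖a‖) := div_nonneg hB0 ha'.le
      intro n
      induction n with
      | zero => exact (hu 0 (by simp)).trans (by linarith)
      | succ n ihn =>
        have h1 := hv n
        rw [aeval_seqShift_X_sub_C] at h1
        have h2 : ‖u (n + 1)‖ ≤ B + ‖a‖ * ‖u n‖ := by
          rw [← norm_mul]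
          calc ‖u (n + 1)‖ = ‖(u (n + 1) - a * u n) + a * u n‖ := by rw [sub_add_cancel]
            _ ≤ _ := (norm_add_le _ _).trans (by linarith)
        have h3 : ‖a‖ * ‖u n‖ ≤ ‖a‖ * (K + B / (1 - ‖a‖)) :=
          mul_le_mul_of_nonneg_left ihn (norm_nonneg a)
        have h4 : (1 - ‖a‖) * (B / (1 - ‖a‖)) = B := mul_div_cancel₀ _ ha'.ne'
        nlinarith [norm_nonneg a]
    · rw [aeval_seqShift_X_sub_C]
      rw [Multiset.card_cons] at hu
      have h1 := hu i (by omega)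
      have h2 := hu (i + 1) (by omega)
      refine (norm_sub_le _ _).trans ?_
      rw [norm_mul]
      nlinarith [norm_nonneg a, norm_nonneg (u i)]

/-- The quotient of the minimal polynomial of `β` by `X - β`. -/
noncomputable def srsPoly (β : ℝ) : ℝ[X] :=
  ∑ j ∈ Finset.range (betaDeg β), C (srsR β (j + 1)) * X ^ j

namespace IsPisot

variable {β : ℝ}

theorem map_minpoly_eq (hβ : IsPisot β) :
    (minpoly ℤ β).map (algebraMap ℤ ℝ) = (X - C β) * srsPoly β := by
  have hm : (minpoly ℤ β).map (algebraMap ℤ ℝ) = X ^ betaDeg β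
      - ∑ j ∈ Finset.range (betaDeg β), C (betaCoeff β j : ℝ) * X ^ j := by
    conv_lhs => rw [(minpoly.monic hβ.2.1).as_sum]
    simp [betaCoeff, betaDeg, Polynomial.map_sum]
  have h1 : ∀ j ∈ Finset.range (betaDeg β), (X - C β) * (C (srsR β (j + 1)) * X ^ j)
      = (C (srsR β (j + 1)) * X ^ (j + 1) - C (srsR β j) * X ^ j)
        - C (betaCoeff β j : ℝ) * X ^ j := by
    intro j _
    have h2 : C (betaCoeff β j : ℝ) = C β * C (srsR β (j + 1)) - C (srsR β j) := by
      rw [← C_mul, mul_srsR_succ hβ.ne_zero, C_add, add_sub_cancel_right]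
    rw [h2]
    ring
  rw [hm, srsPoly, Finset.mul_sum, Finset.sum_congr rfl h1, Finset.sum_sub_distrib,
    Finset.sum_range_sub (fun j => C (srsR β j) * X ^ j), hβ.srsR_betaDeg, srsR_zero]
  simp

theorem monic_srsPoly (hβ : IsPisot β) : (srsPoly β).Monic :=
  (monic_X_sub_C β).of_mul_monic_left (hβ.map_minpoly_eq ▸ (minpoly.monic hβ.2.1).map _)

theorem natDegree_srsPoly (hβ : IsPisot β) : (srsPoly β).natDegree = betaDeg β - 1 := by
  have h := congrArg natDegree hβ.map_minpoly_eq
  rw [(minpoly.monic hβ.2.1).natDegree_map, (monic_X_sub_C β).natDegree_mul hβ.monic_srsPoly,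
    natDegree_X_sub_C] at h
  rw [betaDeg, h, Nat.add_sub_cancel_left]

/-- The root β is simple: the value is that of the derivative of the minimal polynomial, which has
degree below d. Hence all roots of the cofactor are conjugates other than β. -/
theorem eval_srsPoly_ne_zero (hβ : IsPisot β) : (srsPoly β).eval β ≠ 0 := by
  intro h
  have h1 := congrArg (fun p => eval β (derivative p)) hβ.map_minpoly_eq
  simp only [derivative_mul, derivative_X_sub_C, one_mul, eval_add, eval_mul, h, eval_sub, eval_X,
    eval_C, sub_self, zero_mul, add_zero, derivative_map, eval_map_algebraMap] at h1
  have h2 := natDegree_derivative_lt hβ.betaDeg_pos.ne'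
  have h3 := derivative_eq_zero.1 (hβ.eq_zero_of_aeval_eq_zero h2 h1)
  exact hβ.betaDeg_pos.ne' h3

theorem norm_lt_one_of_mem_roots (hβ : IsPisot β) {z : ℂ}
    (hz : z ∈ ((srsPoly β).map (algebraMap ℝ ℂ)).roots) : ‖z‖ < 1 := by
  have hz0 := isRoot_of_mem_roots hz
  refine hβ.2.2 z ?_ ?_
  · have h := congrArg (fun p => eval z (p.map (algebraMap ℝ ℂ))) hβ.map_minpoly_eq
    simp only [Polynomial.map_mul, eval_mul, hz0.eq_zero, mul_zero, Polynomial.map_map] at h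
    rwa [← eval_map_algebraMap, IsScalarTower.algebraMap_eq ℤ ℝ ℂ]
  · rintro rfl
    rw [IsRoot, eval_map, ← Complex.coe_algebraMap, eval₂_at_apply] at hz0
    exact hβ.eval_srsPoly_ne_zero ((map_eq_zero _).1 hz0)

theorem srsPoly_map_eq_prod (hβ : IsPisot β) : (srsPoly β).map (algebraMap ℝ ℂ)
    = (((srsPoly β).map (algebraMap ℝ ℂ)).roots.map fun z => X - C z).prod :=
  (IsAlgClosed.splits _).eq_prod_roots_of_monic (hβ.monic_srsPoly.map _)

theorem card_roots_srsPoly (hβ : IsPisot β) :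
    ((srsPoly β).map (algebraMap ℝ ℂ)).roots.card = betaDeg β - 1 := by
  rw [← (IsAlgClosed.splits _).natDegree_eq_card_roots, natDegree_map, hβ.natDegree_srsPoly]

theorem aeval_seqShift_srsPoly (hβ : IsPisot β) (u : ℕ → ℂ) (n : ℕ) :
    aeval seqShift ((srsPoly β).map (algebraMap ℝ ℂ)) u n
      = u (n + (betaDeg β - 1))
        + ∑ j ∈ Finset.range (betaDeg β - 1), (srsR β (j + 1) : ℂ) * u (n + j) := by
  rw [srsPoly, ← hβ.betaDeg_sub_add, Finset.sum_range_succ, hβ.betaDeg_sub_add, hβ.srsR_betaDeg]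
  simp [Polynomial.map_sum, seqShift_pow_apply, Module.algebraMap_end_apply, add_comm]

/-- Sequences satisfying the linear recurrence with coefficients `r_j` up to a bounded error are
bounded in terms of their first terms. -/
theorem exists_bound_of_recurrence (hβ : IsPisot β) (K : ℝ) : ∃ B : ℝ, ∀ u : ℕ → ℝ,
    (∀ i < betaDeg β - 1, |u i| ≤ K) →
    (∀ n, |u (n + (betaDeg β - 1))
      + ∑ j ∈ Finset.range (betaDeg β - 1), srsR β (j + 1) * u (n + j)| ≤ K) →
    ∀ n, |u n| ≤ B := by
  obtain ⟨B, hB⟩ := exists_bound_of_aeval_seqShift _ (fun z hz => hβ.norm_lt_one_of_mem_roots hz) K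
  refine ⟨B, fun u h1 h2 n => ?_⟩
  have h := hB (fun n => (u n : ℂ)) (fun i hi => ?_) (fun n => ?_) n
  · simpa using h
  · rw [hβ.card_roots_srsPoly] at hi
    simpa using h1 i hi
  · rw [← hβ.srsPoly_map_eq_prod, hβ.aeval_seqShift_srsPoly]
    have := h2 n
    rw [← Real.norm_eq_abs, ← Complex.norm_real] at this
    push_cast at this
    exact this

end IsPisot

/-! ### Chains of τ and τ*, and perturbation of orbits. -/

section Chains

variable {β : ℝ}

theorem srsI_mem_srsQ (β : ℝ) : srsI β ∈ srsQ β :=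
  ⟨0, fun _ => srsI β, rfl, rfl, fun _ h => absurd h (Nat.not_lt_zero _)⟩

/-- Chains can be continued indefinitely. -/
theorem exists_chain_of_mem_srsQ {l : SRSLattice β} (hl : l ∈ srsQ β) :
    ∃ (w : ℕ → SRSLattice β) (N : ℕ), w 0 = srsI β ∧ w N = l ∧
      ∀ n, w (n + 1) = srsTau β (w n) ∨ w (n + 1) = srsTauStar β (w n) := by
  obtain ⟨N, w, h0, hN, hw⟩ := hl
  refine ⟨fun n => (srsTau β)^[n - N] (w (min n N)), N, by simpa using h0, by simpa using hN,
    fun n => ?_⟩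
  rcases lt_or_ge n N with h | h
  · have := hw n h
    simpa [Nat.sub_eq_zero_of_le h.le, Nat.sub_eq_zero_of_le h, min_eq_left h.le,
      min_eq_left (Nat.succ_le_of_lt h)] using this
  · left
    simp only [min_eq_right h, min_eq_right (h.trans n.le_succ)]
    rw [Nat.sub_add_comm h, Function.iterate_succ_apply']

theorem mem_srsQ_of_chain {l l' : SRSLattice β} (hl : l ∈ srsQ β)
    (h : l' = srsTau β l ∨ l' = srsTauStar β l) : l' ∈ srsQ β := by
  obtain ⟨N, w, h0, hN, hw⟩ := hl
  refine ⟨N + 1, fun n => if n ≤ N then w n else l', by simpa using h0, by simp, fun n hn => ?_⟩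
  rcases (Nat.lt_succ_iff.1 hn).lt_or_eq with hn' | rfl
  · simpa [hn'.le, Nat.succ_le_of_lt hn'] using hw n hn'
  · simpa [hN] using h

theorem srsTau_mem_srsQ {l : SRSLattice β} (hl : l ∈ srsQ β) : srsTau β l ∈ srsQ β :=
  mem_srsQ_of_chain hl (Or.inl rfl)

theorem srsTauStar_mem_srsQ {l : SRSLattice β} (hl : l ∈ srsQ β) : srsTauStar β l ∈ srsQ β :=
  mem_srsQ_of_chain hl (Or.inr rfl)

theorem srsTau_iterate_mem_srsQ {l : SRSLattice β} (hl : l ∈ srsQ β) (n : ℕ) :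
    (srsTau β)^[n] l ∈ srsQ β := by
  induction n with
  | zero => exact hl
  | succ n ih => rw [Function.iterate_succ_apply']; exact srsTau_mem_srsQ ih

theorem srsTauStar_neg (l : SRSLattice β) : srsTauStar β (-l) = -srsTau β l := by
  rw [srsTauStar, neg_neg]

theorem srsTau_neg (l : SRSLattice β) : srsTau β (-l) = -srsTauStar β l := by
  rw [srsTauStar, neg_neg]

/-- Negation exchanges τ and τ*, so it turns a chain from l_I into one from -l_I. -/
theorem neg_mem_srsQ (hI : -srsI β ∈ srsQ β) {l : SRSLattice β} (hl : l ∈ srsQ β) :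
    -l ∈ srsQ β := by
  obtain ⟨w, N, h0, rfl, hw⟩ := exists_chain_of_mem_srsQ hl
  induction N with
  | zero => rwa [h0]
  | succ n ih =>
    have := ih ⟨n, w, h0, rfl, fun i _ => hw i⟩
    rcases hw n with h | h
    · rw [h, ← srsTauStar_neg]; exact srsTauStar_mem_srsQ this
    · rw [h, ← srsTau_neg]; exact srsTau_mem_srsQ this

theorem srsTau_apply_last (l : SRSLattice β) (k : Fin (betaDeg β - 1))
    (hk : (k : ℕ) + 1 = betaDeg β - 1) : srsTau β l k = -⌊srsLambda β l⌋ := by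
  simp [srsTau, hk]

theorem srsTau_apply_of_lt (l : SRSLattice β) (k : Fin (betaDeg β - 1))
    (hk : (k : ℕ) + 1 < betaDeg β - 1) : srsTau β l k = l ⟨k + 1, hk⟩ := by
  simp [srsTau, hk]

theorem srsTauStar_apply_last (l : SRSLattice β) (k : Fin (betaDeg β - 1))
    (hk : (k : ℕ) + 1 = betaDeg β - 1) : srsTauStar β l k = -⌈srsLambda β l⌉ := by
  rw [srsTauStar, Pi.neg_apply, srsTau_apply_last _ k hk, srsLambda_neg, Int.floor_neg, neg_neg]

theorem srsTauStar_apply_of_lt (l : SRSLattice β) (k : Fin (betaDeg β - 1))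
    (hk : (k : ℕ) + 1 < betaDeg β - 1) : srsTauStar β l k = l ⟨k + 1, hk⟩ := by
  rw [srsTauStar, Pi.neg_apply, srsTau_apply_of_lt _ k hk, Pi.neg_apply, neg_neg]

theorem srs_ext {l l' : SRSLattice β}
    (h1 : ∀ k : Fin (betaDeg β - 1), (k : ℕ) + 1 < betaDeg β - 1 → l k = l' k)
    (h2 : ∀ k : Fin (betaDeg β - 1), (k : ℕ) + 1 = betaDeg β - 1 → l k = l' k) : l = l' := by
  ext k
  rcases (Nat.succ_le_of_lt k.2).lt_or_eq with h | h
  exacts [h1 k h, h2 k h]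

/-- The integer ⌊x + y⌋ lies between ⌊x⌋ + ⌊y⌋ and ⌊x⌋ + ⌈y⌉, which differ by at most 1. This is why
Q_β is built from both maps. -/
theorem srsTau_add (l q : SRSLattice β) :
    srsTau β (l + q) = srsTau β l + srsTau β q ∨
      srsTau β (l + q) = srsTau β l + srsTauStar β q := by
  have key : ⌊srsLambda β (l + q)⌋ = ⌊srsLambda β l⌋ + ⌊srsLambda β q⌋ ∨
      ⌊srsLambda β (l + q)⌋ = ⌊srsLambda β l⌋ + ⌈srsLambda β q⌉ := by
    rw [srsLambda_add]
    have h1 := Int.le_floor_add (srsLambda β l) (srsLambda β q)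
    have h2 : ⌊srsLambda β l + srsLambda β q⌋ ≤ ⌊srsLambda β l⌋ + ⌈srsLambda β q⌉ := by
      rw [← Int.floor_add_intCast]
      exact Int.floor_mono (add_le_add_right (Int.le_ceil _) _)
    have h3 := Int.ceil_le_floor_add_one (srsLambda β q)
    omega
  refine key.imp (fun h => ?_) fun h => ?_
  · refine srs_ext (fun k hk => ?_) fun k hk => ?_
    · simp [srsTau_apply_of_lt _ _ hk]
    · simp only [srsTau_apply_last _ _ hk, Pi.add_apply, h]
      ring
  · refine srs_ext (fun k hk => ?_) fun k hk => ?_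
    · simp [srsTau_apply_of_lt _ _ hk, srsTauStar_apply_of_lt _ _ hk]
    · simp only [srsTau_apply_last _ _ hk, srsTauStar_apply_last _ _ hk, Pi.add_apply, h]
      ring

theorem exists_srsTau_iterate_add {q : SRSLattice β} (hq : q ∈ srsQ β) (l : SRSLattice β) (n : ℕ) :
    ∃ q' ∈ srsQ β, (srsTau β)^[n] (l + q) = (srsTau β)^[n] l + q' := by
  induction n with
  | zero => exact ⟨q, hq, rfl⟩
  | succ n ih =>
    obtain ⟨q', hq', h⟩ := ih
    rw [Function.iterate_succ_apply', Function.iterate_succ_apply', h]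
    rcases srsTau_add ((srsTau β)^[n] l) q' with h | h
    · exact ⟨_, srsTau_mem_srsQ hq', h⟩
    · exact ⟨_, srsTauStar_mem_srsQ hq', h⟩

theorem mem_srsF_of_iterate {l : SRSLattice β} (n : ℕ) (h : (srsTau β)^[n] l ∈ srsF β) :
    l ∈ srsF β := by
  obtain ⟨k, hk⟩ := h
  exact ⟨k + n, by rw [Function.iterate_add_apply, hk]⟩

theorem zero_mem_srsF (β : ℝ) : (0 : SRSLattice β) ∈ srsF β := ⟨0, rfl⟩

theorem mem_srsP_of_iterate (hpre : srsTau β ⁻¹' srsP β ⊆ srsP β) {l : SRSLattice β} (n : ℕ)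
    (h : (srsTau β)^[n] l ∈ srsP β) : l ∈ srsP β := by
  induction n generalizing l with
  | zero => exact h
  | succ n ih => exact hpre (ih h)

end Chains

/-! ### Finiteness of Q_β and its consequences. -/

namespace IsPisot

variable {β : ℝ}

/-- The vectors of a chain are windows of one integer sequence that satisfies the recurrence with
coefficients r_j up to a rounding error. The error and the entries of l_I are at most 1 in modulus,
so one bound serves all chains. -/
theorem finite_srsQ (hβ : IsPisot β) : (srsQ β).Finite := by
  obtain ⟨B, hB⟩ := hβ.exists_bound_of_recurrence 1
  refine Set.Finite.subset (Set.Finite.pi' (t := fun _ => Set.Icc (-⌊B⌋) ⌊B⌋)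
    fun k => Set.finite_Icc _ _) fun l hl k => ?_
  obtain ⟨w, N, h0, rfl, hw⟩ := exists_chain_of_mem_srsQ hl
  have hD : 0 < betaDeg β - 1 := k.pos
  let u : ℕ → ℤ := fun n => w n ⟨0, hD⟩
  have hu : ∀ j (hj : j < betaDeg β - 1) n, w n ⟨j, hj⟩ = u (n + j) := by
    intro j
    induction j with
    | zero => exact fun _ _ => rfl
    | succ j ih =>
      intro hj n
      have h1 := ih (by omega) (n + 1)
      rw [add_right_comm, add_assoc] at h1
      rw [← h1]
      rcases hw n with h | h
      · rw [h, srsTau_apply_of_lt _ _ hj]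
      · rw [h, srsTauStar_apply_of_lt _ _ hj]
  have hlast : ∀ n, u (n + (betaDeg β - 1)) = -⌊srsLambda β (w n)⌋ ∨
      u (n + (betaDeg β - 1)) = -⌈srsLambda β (w n)⌉ := by
    intro n
    have hk : betaDeg β - 1 - 1 < betaDeg β - 1 := by omega
    have h1 := hu _ hk (n + 1)
    rw [show n + 1 + (betaDeg β - 1 - 1) = n + (betaDeg β - 1) by omega] at h1
    rw [← h1]
    refine (hw n).imp (fun h => ?_) fun h => ?_
    · rw [h, srsTau_apply_last _ _ (Nat.sub_add_cancel hD)]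
    · rw [h, srsTauStar_apply_last _ _ (Nat.sub_add_cancel hD)]
  have hb := hB (fun n => (u n : ℝ)) (fun i hi => ?_) (fun n => ?_) (N + k)
  · have h1 : |u (N + k)| ≤ ⌊B⌋ := Int.le_floor.2 (by simpa using hb)
    rw [← hu k k.2 N] at h1
    exact abs_le.1 h1
  · have h1 := hu i hi 0
    rw [zero_add, h0] at h1
    rw [← h1, srsI]
    split_ifs <;> simp
  · have h1 : srsLambda β (w n)
        = ∑ j ∈ Finset.range (betaDeg β - 1), srsR β (j + 1) * (u (n + j) : ℝ) :=
      srsLambda_eq_sum_range _ (fun j => u (n + j)) fun j => hu j j.2 n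
    rw [← h1, abs_le]
    have h2 := Int.floor_le (srsLambda β (w n))
    have h3 := Int.lt_floor_add_one (srsLambda β (w n))
    have h4 := Int.le_ceil (srsLambda β (w n))
    have h5 := Int.ceil_lt_add_one (srsLambda β (w n))
    rcases hlast n with h | h <;> rw [h] <;> push_cast <;> constructor <;> linarith

theorem abs_le_srsDelta (hβ : IsPisot β) {l : SRSLattice β} (hl : l ∈ srsP β)
    (j : Fin (betaDeg β - 1)) : |l j| ≤ (srsDelta β : ℤ) := by
  have hfin : {m : ℕ | ∃ l ∈ srsP β, ∃ j, m = (l j).natAbs}.Finite := by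
    have h1 : (srsP β).Finite := hβ.finite_srsQ.subset fun l hl => hl.1
    refine (h1.biUnion fun l _ => Set.finite_range fun j => (l j).natAbs).subset ?_
    rintro m ⟨l, hl, j, rfl⟩
    exact Set.mem_biUnion hl ⟨j, rfl⟩
  rw [Int.abs_eq_natAbs, Nat.cast_le]
  exact le_csSup hfin.bddAbove ⟨l, hl, j, rfl⟩

theorem mem_srsF_or_exists_iterate_mem_srsP (hβ : IsPisot β) {l : SRSLattice β}
    (hl : l ∈ srsQ β) : l ∈ srsF β ∨ ∃ n, (srsTau β)^[n] l ∈ srsP β := by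
  obtain ⟨a, -, b, -, hab, h⟩ := Set.infinite_univ.exists_lt_map_eq_of_mapsTo
    (f := fun n : ℕ => (srsTau β)^[n] l) (fun n _ => srsTau_iterate_mem_srsQ hl n) hβ.finite_srsQ
  by_cases h0 : (srsTau β)^[a] l = 0
  · exact Or.inl ⟨a, h0⟩
  · refine Or.inr ⟨a, srsTau_iterate_mem_srsQ hl a, h0, b - a, by omega, ?_⟩
    rw [← Function.iterate_add_apply, Nat.sub_add_cancel hab.le]
    exact h.symm

/-- For l ≠ 0 the number λ(l) is not an integer, so its ceiling is its floor plus 1. -/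
theorem srsTauStar_eq_sub (hβ : IsPisot β) {l : SRSLattice β} (hl : l ≠ 0) :
    srsTauStar β l = srsTau β l - srsI β := by
  refine srs_ext (fun k hk => ?_) fun k hk => ?_
  · simp [srsTau_apply_of_lt _ _ hk, srsTauStar_apply_of_lt _ _ hk, srsI, hk.ne]
  · have h1 : ⌈srsLambda β l⌉ = ⌊srsLambda β l⌋ + 1 := by
      refine le_antisymm (Int.ceil_le_floor_add_one _) (Int.add_one_le_iff.2 (Int.lt_ceil.2 ?_))
      exact (Int.floor_le _).lt_of_ne fun h => hl (hβ.eq_zero_of_srsLambda_eq_intCast h.symm)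
    simp only [srsTau_apply_last _ _ hk, srsTauStar_apply_last _ _ hk, Pi.sub_apply, srsI,
      if_pos hk, h1]
    ring

end IsPisot

/-! ### Orbits of the monoid reach 0. -/

/-- The additive monoid generated by the vectors `-τⁿ(l_I)`. -/
noncomputable def srsNegMonoid (β : ℝ) : AddSubmonoid (SRSLattice β) :=
  AddSubmonoid.closure (Set.range fun n : ℕ => -(srsTau β)^[n] (srsI β))

theorem neg_iterate_mem_srsNegMonoid (β : ℝ) (n : ℕ) :
    -(srsTau β)^[n] (srsI β) ∈ srsNegMonoid β :=
  AddSubmonoid.subset_closure ⟨n, rfl⟩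

theorem mem_srsV_of_mem_srsNegMonoid {β : ℝ} {l : SRSLattice β} (hl : l ∈ srsNegMonoid β) :
    l ∈ srsV β := by
  -- Demanding the identity for all large r allows sums of different lengths to be added.
  suffices h : ∃ (ω : ℕ → ℕ) (N : ℕ), ∀ r ≥ N,
      l = -∑ n ∈ Finset.range r, ω n • (srsTau β)^[n] (srsI β) by
    obtain ⟨ω, N, h⟩ := h
    exact ⟨N + 1, ω, N.succ_pos, h _ N.le_succ⟩
  induction hl using AddSubmonoid.closure_induction with
  | mem x hx =>
    obtain ⟨n, rfl⟩ := hx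
    refine ⟨fun i => if i = n then 1 else 0, n + 1, fun r hr => ?_⟩
    simp [ite_smul, Nat.lt_of_succ_le hr]
  | zero => exact ⟨0, 0, by simp⟩
  | add x y _ _ hx hy =>
    obtain ⟨ω, N, h⟩ := hx
    obtain ⟨ω', N', h'⟩ := hy
    refine ⟨ω + ω', max N N', fun r hr => ?_⟩
    rw [h r ((le_max_left _ _).trans hr), h' r ((le_max_right _ _).trans hr), ← neg_add,
      ← Finset.sum_add_distrib]
    simp [add_smul]

namespace IsPisot

variable {β : ℝ}

theorem srsNegMonoid_subset_srsF_of_neg_srsI_mem (hβ : IsPisot β)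
    (hpre : srsTau β ⁻¹' srsP β ⊆ srsP β)
    (hbox : {l : SRSLattice β | ∀ j, |l j| ≤ (srsDelta β : ℤ)} ∩ srsV β ⊆ srsF β)
    (hI : -srsI β ∈ srsQ β) {l : SRSLattice β} (hl : l ∈ srsNegMonoid β) : l ∈ srsF β := by
  induction hl using AddSubmonoid.closure_induction_right with
  | zero => exact zero_mem_srsF β
  | add_right x hx y hy ih =>
    have hmem : x + y ∈ srsNegMonoid β :=
      add_mem (show x ∈ srsNegMonoid β from hx) (AddSubmonoid.subset_closure hy)
    obtain ⟨n, rfl⟩ := hy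
    obtain ⟨k, hk⟩ := ih
    obtain ⟨q, hq, h⟩ := exists_srsTau_iterate_add
      (neg_mem_srsQ hI (srsTau_iterate_mem_srsQ (srsI_mem_srsQ β) n)) x k
    rw [hk, zero_add] at h
    rcases hβ.mem_srsF_or_exists_iterate_mem_srsP hq with hF | ⟨m, hm⟩
    · exact mem_srsF_of_iterate k (by rwa [h])
    · have hP : x + -(srsTau β)^[n] (srsI β) ∈ srsP β :=
        mem_srsP_of_iterate hpre k (by rw [h]; exact mem_srsP_of_iterate hpre m hm)
      exact hbox ⟨hβ.abs_le_srsDelta hP, mem_srsV_of_mem_srsNegMonoid hmem⟩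

/-- If no nonzero element of `Q_β` is mapped to `0`, then `Q_β` consists of multiples of `l_I`. -/
theorem exists_eq_nsmul_srsI (hβ : IsPisot β) (hpre : srsTau β ⁻¹' srsP β ⊆ srsP β)
    (hI : srsI β ≠ 0) (hQ : ∀ q ∈ srsQ β, srsTau β q = 0 → q = 0) {q : SRSLattice β}
    (hq : q ∈ srsQ β) : ∃ k : ℕ, q = k • srsI β := by
  have hQ' : ∀ n, ∀ q ∈ srsQ β, (srsTau β)^[n] q = 0 → q = 0 := by
    intro n
    induction n with
    | zero => exact fun q _ h => h
    | succ n ih =>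
      intro q hq h
      exact hQ q hq (ih _ (srsTau_mem_srsQ hq) h)
  have hP : ∀ q ∈ srsQ β, q ≠ 0 → q ∈ srsP β := by
    intro q hq h0
    rcases hβ.mem_srsF_or_exists_iterate_mem_srsP hq with ⟨n, hn⟩ | ⟨n, hn⟩
    · exact absurd (hQ' n q hq hn) h0
    · exact mem_srsP_of_iterate hpre n hn
  -- By periodicity q = τ(q') with q' ∈ Q_β nonzero, and then τ*(q') = q - l_I.
  have hsub : ∀ q ∈ srsQ β, q ≠ 0 → q - srsI β ∈ srsQ β := by
    intro q hq h0
    obtain ⟨-, -, N, hN, h⟩ := hP q hq h0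
    have h1 : srsTau β ((srsTau β)^[N - 1] q) = q := by
      rw [← Function.iterate_succ_apply' (srsTau β), Nat.succ_eq_add_one, Nat.sub_add_cancel hN, h]
    have h2 : (srsTau β)^[N - 1] q ≠ 0 := fun h3 => h0 (hQ' _ q hq h3)
    have h3 := srsTauStar_mem_srsQ (srsTau_iterate_mem_srsQ hq (N - 1))
    rwa [hβ.srsTauStar_eq_sub h2, h1] at h3
  by_contra! hne
  -- If q is no multiple of l_I, subtraction never stops, contradicting the finiteness of Q_β.
  have hmem : ∀ k : ℕ, q - k • srsI β ∈ srsQ β := by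
    intro k
    induction k with
    | zero => simpa using hq
    | succ k ih =>
      rw [succ_nsmul, ← sub_sub]
      exact hsub _ ih (sub_ne_zero.2 (hne k))
  obtain ⟨a, -, b, -, hab, h⟩ := Set.infinite_univ.exists_lt_map_eq_of_mapsTo
    (f := fun k : ℕ => q - k • srsI β) (fun k _ => hmem k) hβ.finite_srsQ
  have h1 : (b - a) • srsI β = 0 := by
    rw [sub_nsmul _ hab.le, ← sub_eq_add_neg, sub_eq_zero]
    exact (sub_right_injective h).symm
  rcases smul_eq_zero.1 h1 with h2 | h2
  · omega
  · exact hI h2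

/-- In degree two, all negative multiples of `l_I` reach `0` when `τ(l_I)` is a positive multiple
of `l_I`. -/
theorem neg_nsmul_srsI_mem_srsF (hβ : IsPisot β) (hD : betaDeg β - 1 = 1) {m : ℕ} (hm : m ≠ 0)
    (hτ : srsTau β (srsI β) = m • srsI β) (n : ℕ) : -(n • srsI β) ∈ srsF β := by
  have hlast : ∀ k : Fin (betaDeg β - 1), (k : ℕ) + 1 = betaDeg β - 1 := fun k => by
    have := k.2
    omega
  have hI : ∀ k, srsI β k = 1 := fun k => if_pos (hlast k)
  have hlam : ∀ l : SRSLattice β, ∀ a : ℤ, (∀ k, l k = a) → srsLambda β l = srsR β 1 * a := by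
    intro l a h
    rw [srsLambda_eq_sum_range l (fun _ => a) h, hD, Finset.sum_range_one]
  have hneg : srsR β 1 < 0 := by
    have h1 := congrFun hτ ⟨0, by omega⟩
    rw [srsTau_apply_last _ _ (hlast _), hlam (srsI β) 1 hI, Pi.smul_apply, hI] at h1
    have h2 : ⌊srsR β 1 * ((1 : ℤ) : ℝ)⌋ < 0 := by
      rw [nsmul_one] at h1
      have : (0 : ℤ) < m := by exact_mod_cast Nat.pos_of_ne_zero hm
      omega
    simpa using Int.floor_lt.1 h2
  -- For d = 2 the cofactor of X - β is X + r_1, so -r_1 is the other conjugate. Lying in (0, 1), it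
  -- makes τ send -n·l_I to -a·l_I with 0 ≤ a < n.
  have hlt : -srsR β 1 < 1 := by
    have hz : ((-srsR β 1 : ℝ) : ℂ) ∈ ((srsPoly β).map (algebraMap ℝ ℂ)).roots := by
      rw [mem_roots (hβ.monic_srsPoly.map _).ne_zero, IsRoot, eval_map, ← Complex.coe_algebraMap,
        eval₂_at_apply, srsPoly, ← hβ.betaDeg_sub_add, hD, Finset.sum_range_succ,
        show 1 + 1 = betaDeg β by rw [← hβ.betaDeg_sub_add, hD], hβ.srsR_betaDeg]
      simp
    have h1 := hβ.norm_lt_one_of_mem_roots hz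
    rw [Complex.norm_real, Real.norm_eq_abs] at h1
    exact (le_abs_self _).trans_lt h1
  induction n using Nat.strong_induction_on with
  | _ n ih =>
    rcases Nat.eq_zero_or_pos n with rfl | hn
    · simpa using zero_mem_srsF β
    · have hn' : (0 : ℝ) < n := Nat.cast_pos.2 hn
      obtain ⟨a, ha⟩ := Int.eq_ofNat_of_zero_le
        (Int.floor_nonneg.2 (mul_nonneg (neg_nonneg.2 hneg.le) hn'.le))
      have han : a < n := by
        have h1 : ⌊-srsR β 1 * n⌋ < (n : ℤ) := Int.floor_lt.2 (by push_cast; nlinarith)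
        rw [ha] at h1
        exact_mod_cast h1
      refine mem_srsF_of_iterate 1 ?_
      have h1 : srsTau β (-(n • srsI β)) = -(a • srsI β) := by
        ext k
        rw [srsTau_apply_last _ _ (hlast k), hlam _ (-n) fun k => by simp [hI]]
        simp only [Pi.neg_apply, Pi.smul_apply, hI]
        rw [show srsR β 1 * ((-n : ℤ) : ℝ) = -srsR β 1 * n by push_cast; ring, ha]
        simp
      rw [Function.iterate_one, h1]
      exact ih a han

theorem srsNegMonoid_subset_srsF (hβ : IsPisot β)
    (hpre : srsTau β ⁻¹' srsP β ⊆ srsP β)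
    (hbox : {l : SRSLattice β | ∀ j, |l j| ≤ (srsDelta β : ℤ)} ∩ srsV β ⊆ srsF β)
    {l : SRSLattice β} (hl : l ∈ srsNegMonoid β) : l ∈ srsF β := by
  rcases Nat.eq_zero_or_pos (betaDeg β - 1) with hD | hD
  · have : l = 0 := funext fun k => absurd k.2 (by omega)
    exact this ▸ zero_mem_srsF β
  by_cases hQ : ∀ q ∈ srsQ β, srsTau β q = 0 → q = 0
  swap
  · push Not at hQ
    obtain ⟨v, hv, h0, hv0⟩ := hQ
    refine hβ.srsNegMonoid_subset_srsF_of_neg_srsI_mem hpre hbox ?_ hl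
    have := srsTauStar_mem_srsQ hv
    rwa [hβ.srsTauStar_eq_sub hv0, h0, zero_sub] at this
  have hIlast : srsI β ⟨betaDeg β - 1 - 1, by omega⟩ = 1 := if_pos (Nat.sub_add_cancel hD)
  have hI : srsI β ≠ 0 := fun h => by simp [h] at hIlast
  have hmul := fun q hq => hβ.exists_eq_nsmul_srsI hpre hI hQ (q := q) hq
  obtain ⟨m, hm⟩ := hmul _ (srsTau_mem_srsQ (srsI_mem_srsQ β))
  have hm0 : m ≠ 0 := by
    rintro rfl
    exact hI (hQ _ (srsI_mem_srsQ β) (by simpa using hm))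
  -- For d ≥ 3 the shift moves the entry 1 of l_I to a place where every multiple of l_I vanishes.
  have hD1 : betaDeg β - 1 = 1 := by
    by_contra hD1
    have h1 := congrFun hm ⟨betaDeg β - 1 - 2, by omega⟩
    rw [srsTau_apply_of_lt _ _ (show betaDeg β - 1 - 2 + 1 < betaDeg β - 1 by omega)] at h1
    have h2 : betaDeg β - 1 - 2 + 1 + 1 = betaDeg β - 1 := by omega
    simp [srsI, h2] at h1
    omega
  have hn : ∃ n : ℕ, l = -(n • srsI β) := by
    induction hl using AddSubmonoid.closure_induction with
    | mem x hx =>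
      obtain ⟨n, rfl⟩ := hx
      obtain ⟨k, hk⟩ := hmul _ (srsTau_iterate_mem_srsQ (srsI_mem_srsQ β) n)
      exact ⟨k, congrArg _ hk⟩
    | zero => exact ⟨0, by simp⟩
    | add x y _ _ hx hy =>
      obtain ⟨a, rfl⟩ := hx
      obtain ⟨b, rfl⟩ := hy
      exact ⟨a + b, by rw [add_nsmul, neg_add]⟩
  obtain ⟨n, rfl⟩ := hn
  exact hβ.neg_nsmul_srsI_mem_srsF hD1 hm0 hm n

/-! ### Expansions of integers. -/

/-- The reals congruent modulo `1` to `λ(l)` for some `l` in the monoid generated by the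
`-τⁿ(l_I)`. -/
noncomputable def _root_.srsResidues (β : ℝ) : AddSubmonoid ℝ where
  carrier := {y | ∃ l ∈ srsNegMonoid β, ∃ m : ℤ, y = srsLambda β l + m}
  zero_mem' := ⟨0, zero_mem _, 0, by simp [srsLambda_zero]⟩
  add_mem' := by
    rintro _ _ ⟨l, hl, m, rfl⟩ ⟨l', hl', m', rfl⟩
    exact ⟨l + l', add_mem hl hl', m + m', by rw [srsLambda_add]; push_cast; ring⟩

theorem intCast_mem_srsResidues (β : ℝ) (m : ℤ) : (m : ℝ) ∈ srsResidues β :=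
  ⟨0, zero_mem _, m, by simp [srsLambda_zero]⟩

theorem neg_betaT_iterate_one_mem_srsResidues (hβ : IsPisot β) (n : ℕ) :
    -(betaT β)^[n] 1 ∈ srsResidues β := by
  cases n with
  | zero => simpa using intCast_mem_srsResidues β (-1)
  | succ n =>
    rw [Function.iterate_succ_apply, ← hβ.fract_srsLambda_srsI, ← hβ.fract_srsLambda_iterate]
    refine ⟨_, neg_iterate_mem_srsNegMonoid β n, ⌊srsLambda β ((srsTau β)^[n] (srsI β))⌋, ?_⟩
    rw [srsLambda_neg, Int.fract]
    ring

theorem _root_.betaT_iterate_nonneg (β : ℝ) {x : ℝ} (hx : 0 ≤ x) (n : ℕ) :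
    0 ≤ (betaT β)^[n] x := by
  cases n with
  | zero => exact hx
  | succ n => rw [Function.iterate_succ_apply']; exact Int.fract_nonneg _

theorem _root_.mul_betaT_iterate (β x : ℝ) (n : ℕ) :
    β * (betaT β)^[n] x = (betaT β)^[n + 1] x + betaDigit β x n := by
  rw [Function.iterate_succ_apply', betaDigit, betaT, Int.fract_add_floor]

theorem exists_betaDigit_eq_natCast (hβ : IsPisot β) {x : ℝ} (hx : 0 ≤ x) (n : ℕ) :
    ∃ c : ℕ, betaDigit β x n = c :=
  Int.eq_ofNat_of_zero_le
    (Int.floor_nonneg.2 (mul_nonneg hβ.pos.le (betaT_iterate_nonneg β hx n)))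

/-- From βTⁿ(1) = Tⁿ⁺¹(1) + c one power of β is traded for one iterate of T. The digit c must be
nonnegative, as only a monoid is available. -/
theorem neg_pow_mul_betaT_iterate_one_mem_srsResidues (hβ : IsPisot β) (j n : ℕ) :
    -(β ^ j * (betaT β)^[n] 1) ∈ srsResidues β := by
  induction j generalizing n with
  | zero => simpa using hβ.neg_betaT_iterate_one_mem_srsResidues n
  | succ j ih =>
    obtain ⟨c, hc⟩ := hβ.exists_betaDigit_eq_natCast zero_le_one n
    have h := add_mem (ih (n + 1)) (nsmul_mem (ih 0) c)
    convert h using 1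
    rw [pow_succ, mul_assoc, mul_betaT_iterate, hc]
    simp
    ring

/-- Each step uses β^L T^{k+1}(x) = β^{L+1} T^k(x) - cβ^L with a digit c ≥ 0; at k = 0 the number is
the integer m. -/
theorem betaT_iterate_mem_srsResidues (hβ : IsPisot β) (m : ℤ) {x : ℝ} (hx : 0 ≤ x) (k L : ℕ)
    (hm : β ^ (k + L) * x = m) : β ^ L * (betaT β)^[k] x ∈ srsResidues β := by
  induction k generalizing L with
  | zero =>
    rw [Nat.zero_add] at hm
    simpa [hm] using intCast_mem_srsResidues β m
  | succ k ih =>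
    have h1 := ih (L + 1) (by rw [← hm]; congr 2; ring)
    obtain ⟨c, hc⟩ := hβ.exists_betaDigit_eq_natCast hx k
    have h2 := add_mem h1 (nsmul_mem (hβ.neg_pow_mul_betaT_iterate_one_mem_srsResidues L 0) c)
    convert h2 using 1
    rw [pow_succ, mul_assoc, mul_betaT_iterate, hc]
    simp
    ring

theorem propertyF1_of_srsNegMonoid_subset (hβ : IsPisot β)
    (h : ∀ l ∈ srsNegMonoid β, l ∈ srsF β) : PropertyF1 β := by
  intro m
  refine ⟨m.cast_nonneg, ?_⟩
  set L := betaL β m with hL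
  set x : ℝ := (β ^ L)⁻¹ * m with hx
  have hpow : 0 < β ^ L := pow_pos hβ.pos L
  have hx0 : 0 ≤ x := mul_nonneg (inv_nonneg.2 hpow.le) m.cast_nonneg
  have hx1 : x < 1 := by
    have hne : {n : ℕ | (m : ℝ) * (β ^ n)⁻¹ < 1}.Nonempty := by
      obtain ⟨n, hn⟩ := pow_unbounded_of_one_lt (m : ℝ) hβ.1
      refine ⟨n, ?_⟩
      rw [Set.mem_ofPred_eq, ← div_eq_mul_inv, div_lt_one (pow_pos hβ.pos n)]
      exact hn
    rw [hx, mul_comm]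
    exact Nat.sInf_mem hne
  -- When L = 0 no fractional part has been taken, so the bound must come from x < 1.
  have hy1 : (betaT β)^[L] x < 1 := by
    rcases L with _ | L
    · exact hx1
    · rw [Function.iterate_succ_apply']
      exact Int.fract_lt_one _
  have hy := hβ.betaT_iterate_mem_srsResidues m hx0 L 0
    (by rw [hx, Nat.add_zero, mul_inv_cancel_left₀ hpow.ne']; simp)
  rw [pow_zero, one_mul] at hy
  obtain ⟨l, hl, a, ha⟩ := hy
  have hfr : (betaT β)^[L] x = Int.fract (srsLambda β l) := by
    rw [← Int.fract_eq_self.2 ⟨betaT_iterate_nonneg β hx0 L, hy1⟩, ha, Int.fract_add_intCast]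
  obtain ⟨k, hk⟩ := h l hl
  refine (Set.finite_lt_nat (k + L)).subset fun n hn => ?_
  by_contra hnk
  rw [Set.mem_ofPred_eq, not_lt] at hnk
  refine hn ?_
  have hzero : (betaT β)^[n] x = 0 := by
    obtain ⟨i, rfl⟩ := Nat.exists_eq_add_of_le hnk
    rw [show k + L + i = i + k + L by ring, Function.iterate_add_apply, hfr,
      ← hβ.fract_srsLambda_iterate, Function.iterate_add_apply, hk, srsTau_iterate_zero,
      srsLambda_zero, Int.fract_zero]
  rw [betaDigit, hzero, mul_zero, Int.floor_zero]

end IsPisot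

theorem theorem3 (β : ℝ) (hβ : IsPisot β)
    (h_preimage : srsTau β ⁻¹' srsP β ⊆ srsP β)
    (h_box : {l : SRSLattice β | ∀ j, |l j| ≤ (srsDelta β : ℤ)} ∩ srsV β ⊆ srsF β) :
    PropertyF1 β :=
  hβ.propertyF1_of_srsNegMonoid_subset fun _ hl =>
    hβ.srsNegMonoid_subset_srsF h_preimage h_box hl
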